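/- Let $X$ be a nonempty Tychonoff space and let $C_p(X)$ be the space of continuous real-valued functions on $X$ with the topology of pointwise convergence. Then the following are equivalent: 1. $C_p(X)\models S_1(\mathcal S,\mathcal D)$ and $C_p(X)$ is sequentially separable; 2. $X\models S_1(\Gamma_F,\Omega)$ and $X\models V$; 3. $X\models S_1(\Gamma_{cl},\Omega_{cl})$, $X\models V$, and $X$ is strongly zero-dimensional; 4. $C_p(X)\models S_1(\Gamma_x,\Omega_x)$ and $C_p(X)$ is sequentially separable; 5. $C_p(X)\models S_1(\mathcal S,\Omega_x)$ and $C_p(X)$ is sequentially separable. Here the notions are as follows. - $S_1(\mathcal A,\mathcal B)$: for every sequence $(A_n)_n$ of elements of $\mathcal A$ there are $b_n\in A_n$ with $\{b_n:n\in\mathbb N\}\in\mathcal B$. - For a space $Y$: $\mathcal D$ is the family of dense subsets of $Y$; $\mathcal S$ is the family of sequentially dense subsets of $Y$, that is, of those $A\subseteq Y$ such that every point of $Y$ is the limit of a sequence of points of $A$. The space $Y$ is sequentially separable if it has a countable sequentially dense subset. For $x\in Y$, $\Omega_x=\{A\subseteq Y: x\in\overline A\setminus A\}$, and $\Gamma_x$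 is the family of infinite $A\subseteq Y$ with $x\notin A$ such that $A\setminus U$ is finite for each neighborhood $U$ of $x$. The properties $S_1(\Gamma_x,\Omega_x)$ and $S_1(\mathcal S,\Omega_x)$ of $Y$ are required for every $x\in Y$. - A cover of $X$ is a family $\mathcal U$ of subsets of $X$ with $\bigcup\mathcal U=X$ and $X\notin\mathcal U$. It is an $\omega$-cover if every finite subset of $X$ is contained in a member of $\mathcal U$, and a $\gamma$-cover if it is infinite and each $x\in X$ belongs to all but finitely many members of $\mathcal U$. $\Omega$ is the family of open $\omega$-covers of $X$; $\Omega_{cl}$ and $\Gamma_{cl}$ are the families of $\omega$-covers and of $\gamma$-covers of $X$ by clopen sets. - A zero-set of $X$ is the set of zeros of a continuous function $X\to\mathbb R$; a cozero-set is the complement of a zero-set. $\Gamma_F$ is the family of $\gamma$-covers $\mathcal U$ of $X$ by cozero-sets for which there are zero-sets $F(U)\subseteq U$ ($U\in\mathcal U$) such that $\{F(U):U\in\mathcal U\}$ is a $\gamma$-cover of $X$. - $X\models V$ (Velichko's property): there is a continuous bijection $f$ of $X$ onto a separable metric space $Y$ such that $f(U)$ is an $F_\sigma$-set in $Y$ for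 every cozero-set $U$ of $X$. - $X$ is strongly zero-dimensional if for any two disjoint zero-sets $Z_0,Z_1$ of $X$ there is a clopen set $C$ with $Z_0\subseteq C$ and $C\cap Z_1=\emptyset$. -/

import Mathlib

open Set Filter Topology

namespace SelectionPrinciples

universe u

/-! ### Selection principle -/

/-- The selection hypothesis `S₁(𝒜, ℬ)`: from every sequence of elements of `𝒜` one can choose one
member of each term so that the set of chosen members is an element of `ℬ`. -/
def S1 {α : Type u} (𝒜 ℬ : Set (Set α)) : Prop :=
  ∀ A : ℕ → Set α, (∀ n, A n ∈ 𝒜) → ∃ b : ℕ → α, (∀ n, b n ∈ A n) ∧ Set.range b ∈ ℬ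

/-! ### Families of subsets of a topological space `Y` -/

section Families

variable (Y : Type u) [TopologicalSpace Y]

/-- `𝒟`: the dense subsets of `Y`. -/
def denseSets : Set (Set Y) := {A | Dense A}

/-- `𝒮`: the sequentially dense subsets of `Y`, i.e. those `A` such that every point of `Y` is the
limit of a sequence of points of `A`. -/
def seqDenseSets : Set (Set Y) := {A | seqClosure A = Set.univ}

/-- `Y` is sequentially separable: it has a countable sequentially dense subset. -/
def SequentiallySeparable : Prop := ∃ D : Set Y, D.Countable ∧ D ∈ seqDenseSets Y

variable {Y}

/-- `Ω_y`: the subsets `A` of `Y` with `y ∈ closure A \ A`. -/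
def OmegaAt (y : Y) : Set (Set Y) := {A | y ∈ closure A \ A}

/-- `Γ_y`: the subsets `A` of `Y` that converge to `y`, i.e. `A` is infinite, `y ∉ A`, and `A \ U` is
finite for every neighborhood `U` of `y`. -/
def GammaAt (y : Y) : Set (Set Y) := {A | A.Infinite ∧ y ∉ A ∧ ∀ U ∈ 𝓝 y, (A \ U).Finite}

end Families

/-! ### Covers of a topological space `X` -/

section Covers

variable {X : Type u}

/-- A (nontrivial) cover of `X`: a family of subsets with union `X` of which `X` is not a member. -/
def IsCover (𝒰 : Set (Set X)) : Prop := ⋃₀ 𝒰 = Set.univ ∧ Set.univ ∉ 𝒰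

/-- A `γ`-cover: an infinite cover such that each point lies in all but finitely many members. -/
def IsGammaCover (𝒰 : Set (Set X)) : Prop :=
  IsCover 𝒰 ∧ 𝒰.Infinite ∧ ∀ x : X, {U ∈ 𝒰 | x ∉ U}.Finite

/-- An `ω`-cover: a cover such that each finite subset of `X` is contained in a member. -/
def IsOmegaCover (𝒰 : Set (Set X)) : Prop :=
  IsCover 𝒰 ∧ ∀ K : Set X, K.Finite → ∃ U ∈ 𝒰, K ⊆ U

variable [TopologicalSpace X]

/-- A zero-set: the preimage of zero under a continuous real-valued function. -/
def IsZeroSet (Z : Set X) : Prop := ∃ f : X → ℝ, Continuous f ∧ Z = f ⁻¹' {0}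

/-- A cozero-set: the complement of a zero-set. -/
def IsCozeroSet (U : Set X) : Prop := IsZeroSet Uᶜ

variable (X)

/-- `Ω`: the open `ω`-covers of `X`. -/
def Omega : Set (Set (Set X)) := {𝒰 | (∀ U ∈ 𝒰, IsOpen U) ∧ IsOmegaCover 𝒰}

/-- `Ω_cl`: the clopen `ω`-covers of `X`. -/
def OmegaCl : Set (Set (Set X)) := {𝒰 | (∀ U ∈ 𝒰, IsClopen U) ∧ IsOmegaCover 𝒰}

/-- `Γ_cl`: the clopen `γ`-covers of `X`. -/
def GammaCl : Set (Set (Set X)) := {𝒰 | (∀ U ∈ 𝒰, IsClopen U) ∧ IsGammaCover 𝒰}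

/-- `Γ_F`: the `γ_F`-shrinkable `γ`-covers of `X`, i.e. the `γ`-covers `𝒰` by cozero-sets for which
there are zero-sets `F U ⊆ U` (`U ∈ 𝒰`) such that `{F U | U ∈ 𝒰}` is a `γ`-cover. -/
def GammaF : Set (Set (Set X)) :=
  {𝒰 | (∀ U ∈ 𝒰, IsCozeroSet U) ∧ IsGammaCover 𝒰 ∧
    ∃ F : Set X → Set X, (∀ U ∈ 𝒰, IsZeroSet (F U) ∧ F U ⊆ U) ∧ IsGammaCover (F '' 𝒰)}

/-- `X` is strongly zero-dimensional: any two disjoint zero-sets are separated by a clopen set. -/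
def StronglyZeroDimensional : Prop :=
  ∀ Z₀ Z₁ : Set X, IsZeroSet Z₀ → IsZeroSet Z₁ → Disjoint Z₀ Z₁ →
    ∃ C : Set X, IsClopen C ∧ Z₀ ⊆ C ∧ Disjoint C Z₁

/-- Velichko's property `V`: there is a continuous bijection of `X` onto a separable metric space
that maps every cozero-set of `X` onto an `F_σ`-set. -/
def VelichkoV : Prop :=
  ∃ (Y : Type u) (_ : MetricSpace Y) (_ : TopologicalSpace.SeparableSpace Y) (f : X → Y),
    Continuous f ∧ Function.Bijective f ∧
    ∀ U : Set X, IsCozeroSet U → ∃ F : ℕ → Set Y, (∀ n, IsClosed (F n)) ∧ f '' U = ⋃ n, F n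

/-- `C_p(X)`: the continuous real-valued functions on `X` with the topology of pointwise
convergence, as a subspace of the product `X → ℝ`. -/
abbrev Cp : Type u := {f : X → ℝ // Continuous f}

end Covers

end SelectionPrinciples

/-!
`X ⊨ V` and the sequential separability of `C_p(X)` are the same property. For a continuous
bijection `u` onto a separable metric space, viewed inside the Hilbert cube, the hypothesis on
cozero-sets makes every continuous function on `X` a Baire-one function of `u` (Lebesgue–Hausdorff),
so that the pullbacks of a countable dense set of continuous functions on the cube are sequentially
dense. Conversely the evaluations of a sequentially dense sequence define such a `u`.

The selection principles all say that from countably many sequences of continuous functions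
converging pointwise to `0` one can select one function each so that `0` is in the closure of the
selection. To a null sequence `g` correspond the cozero-sets `{|g j| < ε}` shrunk to the zero-sets
`{|g j| ≤ ε / 2}`, and since multiples of a null sequence are again null, a fixed `ε` is enough.

This principle passes to continuous images and fails for the Hilbert cube, where bumps of height `1`
around the points `1 / (j + 1)` of each axis are null sequences and every selection is equal to `1`
at a common point. It therefore fails for `[0, 1]`, which maps onto the cube. So every continuous
function on `X` omits a value in `[0, 1]`, which yields clopen sets separating disjoint zero-sets,
and conversely strong zero-dimensionality refines zero-sets inside cozero-sets to clopen sets.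
-/

namespace SelectionPrinciples

/-! ### Selections from convergent sequences -/

section ConvergentSelection

theorem S1.mono {α : Type*} {𝒜 ℬ ℬ' : Set (Set α)} (h : S1 𝒜 ℬ) (hℬ : ℬ ⊆ ℬ') : S1 𝒜 ℬ' :=
  fun A hA => (h A hA).imp fun _ hb => ⟨hb.1, hℬ hb.2⟩

variable {Y : Type*} [TopologicalSpace Y] {y : Y}

/-- The selection principle `S₁(Γ_y, Ω_y)` for convergent sequences in place of convergent sets: the
sequences may repeat values and take the value `y`, and so may the selection. -/
def ConvergentSelectionAt (y : Y) : Prop :=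
  ∀ a : ℕ → ℕ → Y, (∀ n, Tendsto (a n) atTop (𝓝 y)) →
    ∃ φ : ℕ → ℕ, y ∈ closure (range fun n => a n (φ n))

theorem range_mem_gammaAt [T1Space Y] {ι : Type*} [Infinite ι] {a : ι → Y}
    (ha : Tendsto a cofinite (𝓝 y)) (hne : ∀ i, a i ≠ y) : range a ∈ GammaAt y := by
  have hy : y ∉ range a := by simpa using hne
  refine ⟨fun hfin => hy ?_, hy, fun U hU => ?_⟩
  · exact hfin.isClosed.mem_of_tendsto ha (Eventually.of_forall mem_range_self)
  · refine ((mem_cofinite.1 (ha hU)).image a).subset ?_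
    rintro _ ⟨⟨i, rfl⟩, hi⟩
    exact mem_image_of_mem a hi

theorem exists_seq_tendsto_of_mem_gammaAt {A : Set Y} (hA : A ∈ GammaAt y) :
    ∃ a : ℕ → Y, (∀ j, a j ∈ A) ∧ Tendsto a atTop (𝓝 y) := by
  let e : ℕ ↪ A := hA.1.natEmbedding
  have he : Function.Injective fun j => (e j : Y) := Subtype.val_injective.comp e.injective
  refine ⟨fun j => e j, fun j => (e j).2, fun U hU => ?_⟩
  rw [← Nat.cofinite_eq_atTop]
  exact ((hA.2.2 U hU).preimage he.injOn).subset fun j hj => ⟨(e j).2, hj⟩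

theorem s1_gammaAt_omegaAt_iff [T1Space Y] :
    S1 (GammaAt y) (OmegaAt y) ↔ ConvergentSelectionAt y := by
  constructor
  · intro h a ha
    by_cases hy : ∃ n j, a n j = y
    · obtain ⟨n, j, rfl⟩ := hy
      exact ⟨fun _ => j, subset_closure ⟨n, rfl⟩⟩
    · push Not at hy
      obtain ⟨b, hb, hyb, -⟩ := h (fun n => range (a n)) fun n =>
        range_mem_gammaAt (Nat.cofinite_eq_atTop ▸ ha n) (hy n)
      choose φ hφ using hb
      exact ⟨φ, by simpa only [hφ] using hyb⟩
  · intro h A hA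
    choose a haA ha using fun n => exists_seq_tendsto_of_mem_gammaAt (hA n)
    obtain ⟨φ, hφ⟩ := h a ha
    refine ⟨fun n => a n (φ n), fun n => haA n _, hφ, ?_⟩
    rintro ⟨n, rfl⟩
    exact (hA n).2.1 (haA n _)

theorem exists_forall_mem_closure_range {y : ℕ → Y} (h : ∀ i, ConvergentSelectionAt (y i))
    {a : ℕ → ℕ → Y} (ha : ∀ n, Tendsto (a n) atTop (𝓝 (y n.unpair.1))) :
    ∃ φ : ℕ → ℕ, ∀ i, y i ∈ closure (range fun n => a n (φ n)) := by
  choose φ hφ using fun i => h i (fun m => a (Nat.pair i m)) fun m => by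
    simpa only [Nat.unpair_pair] using ha (Nat.pair i m)
  refine ⟨fun n => φ n.unpair.1 n.unpair.2, fun i => closure_mono ?_ (hφ i)⟩
  rintro _ ⟨m, rfl⟩
  exact ⟨Nat.pair i m, by simp only [Nat.unpair_pair]⟩

theorem exists_dense_range_selection [Nonempty Y] (h : ∀ y : Y, ConvergentSelectionAt y)
    {D : Set Y} (hDc : D.Countable) (hD : Dense D) {A : ℕ → Set Y}
    (hA : ∀ n, D ⊆ seqClosure (A n)) : ∃ b : ℕ → Y, (∀ n, b n ∈ A n) ∧ Dense (range b) := by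
  obtain ⟨d, rfl⟩ := hDc.exists_eq_range hD.nonempty
  choose a haA ha using fun n : ℕ => hA n (mem_range_self n.unpair.1)
  obtain ⟨φ, hφ⟩ := exists_forall_mem_closure_range (fun i => h (d i)) ha
  exact ⟨fun n => a n (φ n), fun n => haA n _,
    dense_closure.1 (hD.mono (range_subset_iff.2 hφ))⟩

theorem dense_of_mem_seqDenseSets {A : Set Y} (hA : A ∈ seqDenseSets Y) : Dense A := fun y =>
  seqClosure_subset_closure (hA.ge (mem_univ y))

theorem s1_seqDenseSets_denseSets [Nonempty Y] [TopologicalSpace.SeparableSpace Y]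
    (h : ∀ y : Y, ConvergentSelectionAt y) : S1 (seqDenseSets Y) (denseSets Y) := by
  intro A hA
  obtain ⟨D, hDc, hD⟩ := TopologicalSpace.exists_countable_dense Y
  exact exists_dense_range_selection h hDc hD fun n => (hA n).ge.trans' (subset_univ D)

theorem mem_seqClosure_diff_singleton [T1Space Y] {A : Set Y} {z : Y} (hz : z ∈ seqClosure A)
    (hzy : z ≠ y) : z ∈ seqClosure (A \ {y}) := by
  obtain ⟨a, haA, ha⟩ := hz
  obtain ⟨N, hN⟩ := eventually_atTop.1 (ha.eventually_ne hzy)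
  exact ⟨fun j => a (j + N), fun j => ⟨haA _, hN _ (Nat.le_add_left N j)⟩,
    (tendsto_add_atTop_iff_nat N).2 ha⟩

theorem s1_seqDenseSets_omegaAt [T1Space Y] [TopologicalSpace.SeparableSpace Y]
    (h : ∀ y : Y, ConvergentSelectionAt y) (y : Y) [NeBot (𝓝[≠] y)] :
    S1 (seqDenseSets Y) (OmegaAt y) := by
  intro A hA
  have : Nonempty Y := ⟨y⟩
  obtain ⟨D, hDc, hD⟩ := TopologicalSpace.exists_countable_dense Y
  obtain ⟨b, hb, hbd⟩ := exists_dense_range_selection h (hDc.mono sdiff_subset)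
    (hD.sdiff_singleton y) (A := fun n => A n \ {y}) fun n z hz =>
      mem_seqClosure_diff_singleton ((hA n).ge (mem_univ z)) hz.2
  refine ⟨b, fun n => (hb n).1, hbd y, ?_⟩
  rintro ⟨n, rfl⟩
  exact (hb n).2 rfl

theorem SequentiallySeparable.separableSpace (h : SequentiallySeparable Y) :
    TopologicalSpace.SeparableSpace Y :=
  let ⟨D, hDc, hD⟩ := h
  ⟨D, hDc, dense_of_mem_seqDenseSets hD⟩

theorem SequentiallySeparable.exists_seq [Nonempty Y] (h : SequentiallySeparable Y) :
    ∃ d : ℕ → Y, ∀ y, ∃ k : ℕ → ℕ, Tendsto k atTop atTop ∧ Tendsto (d ∘ k) atTop (𝓝 y) := by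
  obtain ⟨D, hDc, hD⟩ := h
  obtain ⟨d, rfl⟩ := hDc.exists_eq_range (dense_of_mem_seqDenseSets hD).nonempty
  -- Every value is repeated infinitely often, so the indices can be made to tend to infinity.
  refine ⟨fun n => d n.unpair.1, fun y => ?_⟩
  obtain ⟨a, ha, hay⟩ := hD.ge (mem_univ y)
  choose i hi using ha
  refine ⟨fun k => Nat.pair (i k) k, tendsto_atTop_mono (fun k => Nat.right_le_pair _ _) tendsto_id,
    hay.congr fun k => ?_⟩
  simp only [Function.comp_apply, Nat.unpair_pair, hi]

end ConvergentSelection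

/-! ### Pointwise null sequences of continuous functions -/

section NullSelection

variable {X : Type*} [TopologicalSpace X]

instance : Nonempty (Cp X) := ⟨⟨0, continuous_zero⟩⟩

theorem Cp.tendsto_iff {ι : Type*} {l : Filter ι} {a : ι → Cp X} {f : Cp X} :
    Tendsto a l (𝓝 f) ↔ ∀ x, Tendsto (fun i => (a i).1 x) l (𝓝 (f.1 x)) := by
  rw [tendsto_subtype_rng, tendsto_pi_nhds]

theorem Cp.nhds_hasBasis (f : Cp X) :
    (𝓝 f).HasBasis (fun p : Set X × ℝ => p.1.Finite ∧ 0 < p.2)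
      fun p => {a | ∀ x ∈ p.1, |a.1 x - f.1 x| < p.2} := by
  rw [nhds_subtype_eq_comap, nhds_pi]
  refine (hasBasis_pi_same_index (fun x => Metric.nhds_basis_ball) ?_).comap Subtype.val
  intro K ε hK hε
  have hsmall : ∀ᶠ δ in 𝓝[>] (0 : ℝ), ∀ x ∈ K, δ ≤ ε x :=
    (eventually_all_finite hK).2 fun x hx =>
      (eventually_le_nhds (hε x hx)).filter_mono nhdsWithin_le_nhds
  obtain ⟨δ, hδε, hδ⟩ := (hsmall.and self_mem_nhdsWithin).exists
  exact ⟨δ, hδ, fun x hx => Metric.ball_subset_ball (hδε x hx)⟩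

theorem Cp.mem_closure_range_iff {ι : Type*} {b : ι → Cp X} {f : Cp X} :
    f ∈ closure (range b) ↔
      ∀ K : Set X, K.Finite → ∀ ε : ℝ, 0 < ε → ∃ i, ∀ x ∈ K, |(b i).1 x - f.1 x| < ε := by
  simp only [mem_closure_iff_nhds_basis (Cp.nhds_hasBasis f), exists_range_iff, Prod.forall,
    and_imp, mem_ofPred_eq]
  exact forall_congr' fun K => forall_comm

instance Cp.nhdsNE_neBot [Nonempty X] (f : Cp X) : NeBot (𝓝[≠] f) := by
  let a : ℕ → Cp X := fun n =>
    ⟨fun x => f.1 x + 1 / ((n : ℝ) + 1), f.2.add continuous_const⟩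
  have ha : Tendsto a atTop (𝓝 f) := Cp.tendsto_iff.2 fun x => by
    simpa [a] using (tendsto_one_div_add_atTop_nhds_zero_nat (𝕜 := ℝ)).const_add (f.1 x)
  have hne (n : ℕ) : a n ≠ f := fun h => by
    obtain ⟨x⟩ := ‹Nonempty X›
    have hx : f.1 x + 1 / ((n : ℝ) + 1) = f.1 x := congrFun (congrArg Subtype.val h) x
    exact Nat.one_div_pos_of_nat.ne' (left_eq_add.1 hx.symm)
  exact mem_closure_iff_nhdsWithin_neBot.1
    (mem_closure_of_tendsto ha (Eventually.of_forall hne))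

variable (X) in
/-- The property of `X` to which every clause of the theorem reduces: from every sequence of
pointwise null sequences of continuous functions one can select a member of each so that every
finite set has a selected function smaller than `1` on it. Scaling shows that the bound `1` stands
for an arbitrarily small one. -/
def NullSelection : Prop :=
  ∀ g : ℕ → ℕ → X → ℝ, (∀ n j, Continuous (g n j)) →
    (∀ n x, Tendsto (fun j => g n j x) atTop (𝓝 0)) →
    ∃ φ : ℕ → ℕ, ∀ K : Set X, K.Finite → ∃ n, ∀ x ∈ K, |g n (φ n) x| < 1

theorem NullSelection.convergentSelectionAt (h : NullSelection X) (f : Cp X) :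
    ConvergentSelectionAt f := by
  intro a ha
  -- The `k`-th block of indices is used with precision `1 / (k + 1)`.
  choose φ hφ using fun k : ℕ =>
    h (fun m j x => (k + 1) * ((a (Nat.pair k m) j).1 x - f.1 x))
      (fun m j => continuous_const.mul ((a _ j).2.sub f.2)) fun m x => by
        simpa using ((Cp.tendsto_iff.1 (ha _) x).sub_const (f.1 x)).const_mul ((k : ℝ) + 1)
  refine ⟨fun n => φ n.unpair.1 n.unpair.2, Cp.mem_closure_range_iff.2 fun K hK ε hε => ?_⟩
  obtain ⟨k, hk⟩ := exists_nat_one_div_lt hε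
  obtain ⟨m, hm⟩ := hφ k K hK
  refine ⟨Nat.pair k m, fun x hx => lt_trans ?_ hk⟩
  have hkpos : (0 : ℝ) < k + 1 := k.cast_add_one_pos
  simpa only [Nat.unpair_pair, abs_mul, abs_of_pos hkpos, lt_div_iff₀' hkpos] using hm x hx

theorem ConvergentSelectionAt.nullSelection {f : Cp X} (h : ConvergentSelectionAt f) :
    NullSelection X := by
  intro g hg hg0
  obtain ⟨φ, hφ⟩ := h (fun n j => ⟨fun x => f.1 x + g n j x, f.2.add (hg n j)⟩) fun n =>
    Cp.tendsto_iff.2 fun x => by simpa using (hg0 n x).const_add (f.1 x)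
  exact ⟨φ, fun K hK => by simpa using Cp.mem_closure_range_iff.1 hφ K hK 1 one_pos⟩

theorem nullSelection_iff_forall_s1_gammaAt_omegaAt :
    NullSelection X ↔ ∀ f : Cp X, S1 (GammaAt f) (OmegaAt f) := by
  simp only [s1_gammaAt_omegaAt_iff]
  exact ⟨NullSelection.convergentSelectionAt, fun h => (h ⟨0, continuous_zero⟩).nullSelection⟩

theorem SequentiallySeparable.nullSelection (hs : SequentiallySeparable (Cp X)) {f : Cp X}
    (h : S1 (seqDenseSets (Cp X)) {A | f ∈ closure A}) : NullSelection X := by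
  intro g hg hg0
  obtain ⟨d, hd⟩ := hs.exists_seq
  let t : ℕ → ℕ → X → ℝ := fun n j x => min 1 |g n j x|
  have ht (n j) : Continuous (t n j) := continuous_const.min (hg n j).abs
  have ht0 (n x) : Tendsto (fun j => t n j x) atTop (𝓝 0) := by
    simpa [t] using (tendsto_const_nhds (x := (1 : ℝ))).min (hg0 n x).abs
  -- `a n j` agrees with `f + 1` wherever `|g n j| ≥ 1`, but is asymptotic to `d j` as `j → ∞`.
  let a : ℕ → ℕ → Cp X := fun n j =>
    ⟨fun x => (d j).1 x * (1 - t n j x) + (f.1 x + 1) * t n j x,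
      ((d j).2.mul (continuous_const.sub (ht n j))).add ((f.2.add continuous_const).mul (ht n j))⟩
  have ha (n) : range (a n) ∈ seqDenseSets (Cp X) := by
    refine eq_univ_of_forall fun y => ?_
    obtain ⟨k, hk, hky⟩ := hd y
    refine ⟨fun i => a n (k i), fun i => mem_range_self _, Cp.tendsto_iff.2 fun x => ?_⟩
    have htk : Tendsto (fun i => t n (k i) x) atTop (𝓝 0) := (ht0 n x).comp hk
    simpa using ((Cp.tendsto_iff.1 hky x).mul (htk.const_sub 1)).add (htk.const_mul (f.1 x + 1))
  obtain ⟨b, hb, hfb⟩ := h (fun n => range (a n)) ha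
  choose φ hφ using hb
  refine ⟨φ, fun K hK => ?_⟩
  obtain ⟨n, hn⟩ := Cp.mem_closure_range_iff.1 hfb K hK 1 one_pos
  refine ⟨n, fun x hx => ?_⟩
  by_contra! hge
  have htx : t n (φ n) x = 1 := min_eq_left hge
  have hax : (b n).1 x = f.1 x + 1 := by simp [← hφ n, a, htx]
  simpa [hax] using hn x hx

end NullSelection

/-! ### Covers -/

section Covers

variable {X : Type*}

theorem isGammaCover_range {ι : Type*} [Infinite ι] {S : ι → Set X} (hne : ∀ i, S i ≠ univ)
    (h : ∀ x, ∀ᶠ i in cofinite, x ∈ S i) : IsGammaCover (range S) := by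
  refine ⟨⟨eq_univ_of_forall fun x => ?_, ?_⟩, fun hfin => ?_, fun x => ?_⟩
  · obtain ⟨i, hi⟩ := (h x).exists
    exact ⟨S i, mem_range_self i, hi⟩
  · rintro ⟨i, hi⟩
    exact hne i hi
  · have := hfin.to_subtype
    obtain ⟨⟨_, i, rfl⟩, hi⟩ := Finite.exists_infinite_fiber (rangeFactorization S)
    have hfreq : ∃ᶠ j in cofinite, S j = S i := by
      refine frequently_cofinite_iff_infinite.2 ((infinite_coe_iff.1 hi).mono fun j hj => ?_)
      exact congrArg Subtype.val hj
    refine hne i (eq_univ_of_forall fun x => ?_)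
    obtain ⟨j, hji, hj⟩ := (hfreq.and_eventually (h x)).exists
    exact hji ▸ hj
  · refine ((h x).image S).subset ?_
    rintro _ ⟨⟨i, rfl⟩, hi⟩
    exact mem_image_of_mem S hi

theorem isOmegaCover_range {ι : Type*} {b : ι → Set X} (hne : ∀ i, b i ≠ univ)
    (h : ∀ K : Set X, K.Finite → ∃ i, K ⊆ b i) : IsOmegaCover (range b) := by
  refine ⟨⟨eq_univ_of_forall fun x => ?_, ?_⟩, fun K hK => exists_range_iff.2 (h K hK)⟩
  · obtain ⟨i, hi⟩ := h {x} (finite_singleton x)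
    exact ⟨b i, mem_range_self i, hi rfl⟩
  · rintro ⟨i, hi⟩
    exact hne i hi

variable [TopologicalSpace X]

theorem IsZeroSet.isClosed {Z : Set X} (h : IsZeroSet Z) : IsClosed Z := by
  obtain ⟨f, hf, rfl⟩ := h
  exact isClosed_singleton.preimage hf

theorem IsCozeroSet.isOpen {U : Set X} (h : IsCozeroSet U) : IsOpen U :=
  isClosed_compl_iff.1 (IsZeroSet.isClosed h)

theorem isZeroSet_le {f g : X → ℝ} (hf : Continuous f) (hg : Continuous g) :
    IsZeroSet {x | f x ≤ g x} :=
  ⟨fun x => max (f x - g x) 0, (hf.sub hg).max continuous_const, by ext x; simp⟩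

theorem isCozeroSet_lt {f g : X → ℝ} (hf : Continuous f) (hg : Continuous g) :
    IsCozeroSet {x | f x < g x} := by
  simpa only [IsCozeroSet, compl_ofPred, not_lt] using isZeroSet_le hg hf

theorem isZeroSet_of_isClopen {C : Set X} (hC : IsClopen C) : IsZeroSet C := by
  classical
  refine ⟨Cᶜ.indicator 1, hC.compl.continuous_indicator continuous_one, ?_⟩
  ext x
  by_cases hx : x ∈ C <;> simp [hx]

theorem isCozeroSet_of_isClopen {C : Set X} (hC : IsClopen C) : IsCozeroSet C :=
  isZeroSet_of_isClopen hC.compl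

theorem IsZeroSet.exists_separating {Z₀ Z₁ : Set X} (h₀ : IsZeroSet Z₀) (h₁ : IsZeroSet Z₁)
    (hd : Disjoint Z₀ Z₁) :
    ∃ f : X → ℝ, Continuous f ∧ (∀ x ∈ Z₀, f x = 0) ∧ ∀ x ∈ Z₁, f x = 1 := by
  obtain ⟨a, ha, rfl⟩ := h₀
  obtain ⟨b, hb, rfl⟩ := h₁
  have hne (x) : |a x| + |b x| ≠ 0 := fun h => by
    obtain ⟨hax, hbx⟩ := (add_eq_zero_iff_of_nonneg (abs_nonneg _) (abs_nonneg _)).1 h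
    exact disjoint_left.1 hd (abs_eq_zero.1 hax) (abs_eq_zero.1 hbx)
  refine ⟨fun x => |a x| / (|a x| + |b x|), ha.abs.div (ha.abs.add hb.abs) hne,
    fun x (hx : a x = 0) => by simp [hx], fun x (hx : b x = 0) => ?_⟩
  simpa [hx] using hne x

theorem exists_seq_of_mem_gammaF {𝒰 : Set (Set X)} (h : 𝒰 ∈ GammaF X) :
    ∃ U F : ℕ → Set X, (∀ j, U j ∈ 𝒰) ∧ (∀ j, IsZeroSet (F j)) ∧ (∀ j, F j ⊆ U j) ∧
      ∀ x, ∀ᶠ j in atTop, x ∈ F j := by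
  obtain ⟨-, -, F, hF, -, hinf, hfin⟩ := h
  let e : ℕ ↪ F '' 𝒰 := hinf.natEmbedding
  choose U hU hFU using fun j => (e j).2
  refine ⟨U, F ∘ U, hU, fun j => (hF _ (hU j)).1, fun j => (hF _ (hU j)).2, fun x => ?_⟩
  rw [show F ∘ U = fun j => ↑(e j) from funext hFU, ← Nat.cofinite_eq_atTop]
  exact ((hfin x).preimage (Subtype.val_injective.comp e.injective).injOn).subset
    fun j hj => ⟨(e j).2, hj⟩

theorem range_mem_gammaF {U F : ℕ → Set X} (hU : ∀ j, IsCozeroSet (U j))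
    (hF : ∀ j, IsZeroSet (F j)) (hFU : ∀ j, F j ⊆ U j) (hne : ∀ j, U j ≠ univ)
    (h : ∀ x, ∀ᶠ j in atTop, x ∈ F j) : range U ∈ GammaF X := by
  have hcof (x) : ∀ᶠ j in cofinite, x ∈ F j := Nat.cofinite_eq_atTop ▸ h x
  have hγ : IsGammaCover (range U) :=
    isGammaCover_range hne fun x => (hcof x).mono fun j hj => hFU j hj
  -- Indices `r V` with `U (r V) = V`: the shrinking of a member `V` of the cover is `F (r V)`.
  choose! r hr using fun V : Set X => (id : V ∈ range U → ∃ j, U j = V)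
  have hrinj : Function.Injective fun V : range U => r V := fun V W hVW =>
    Subtype.ext ((hr V V.2).symm.trans ((congrArg U hVW).trans (hr W W.2)))
  have : Infinite (range U) := infinite_coe_iff.2 hγ.2.1
  refine ⟨forall_mem_range.2 hU, hγ, fun V => F (r V), fun V hV => ⟨hF _, ?_⟩, ?_⟩
  · exact (hFU _).trans (hr V hV).le
  · rw [image_eq_range]
    exact isGammaCover_range (fun V hV => hne _ (univ_subset_iff.1 (hV ▸ hFU (r V))))
      fun x => hrinj.tendsto_cofinite.eventually (hcof x)

end Covers

section CoverSelection

variable {X : Type*} [TopologicalSpace X]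

theorem NullSelection.s1_gammaF_omega (h : NullSelection X) : S1 (GammaF X) (Omega X) := by
  intro 𝒰 h𝒰
  choose U F hU hF hFU hlim using fun n => exists_seq_of_mem_gammaF (h𝒰 n)
  choose g hg hgF hgU using fun n j =>
    (hF n j).exists_separating ((h𝒰 n).1 _ (hU n j)) (disjoint_compl_right_iff_subset.2 (hFU n j))
  obtain ⟨φ, hφ⟩ := h g hg fun n x =>
    tendsto_const_nhds.congr' ((hlim n x).mono fun j hj => (hgF n j x hj).symm)
  refine ⟨fun n => U n (φ n), fun n => hU n _,
    forall_mem_range.2 fun n => ((h𝒰 n).1 _ (hU n _)).isOpen,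
    isOmegaCover_range (fun n he => (h𝒰 n).2.1.1.2 (he ▸ hU n _)) fun K hK => ?_⟩
  obtain ⟨n, hn⟩ := hφ K hK
  refine ⟨n, fun x hx => by_contra fun hxU => ?_⟩
  simpa [hgU n (φ n) x hxU] using hn x hx

theorem NullSelection.of_s1_gammaF_omega (h : S1 (GammaF X) (Omega X)) : NullSelection X := by
  intro g hg hg0
  by_cases hsmall : ∃ n j, ∀ x, |g n j x| < 1
  · obtain ⟨n, j, hj⟩ := hsmall
    exact ⟨fun _ => j, fun K _ => ⟨n, fun x _ => hj x⟩⟩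
  have hcover (n) : range (fun j => {x | |g n j x| < 1}) ∈ GammaF X := by
    refine range_mem_gammaF (F := fun j => {x | |g n j x| ≤ 1 / 2})
      (fun j => isCozeroSet_lt (hg n j).abs continuous_const)
      (fun j => isZeroSet_le (hg n j).abs continuous_const)
      (fun j x (hx : |g n j x| ≤ 1 / 2) => hx.trans_lt one_half_lt_one)
      (fun j hj => hsmall ⟨n, j, eq_univ_iff_forall.1 hj⟩) fun x => ?_
    exact (hg0 n x).abs.eventually_le_const (by simp)
  obtain ⟨b, hb, -, hω⟩ := h _ hcover
  choose φ hφ using hb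
  obtain rfl : (fun n => {x | |g n (φ n) x| < 1}) = b := funext hφ
  exact ⟨φ, fun K hK => exists_range_iff.1 (hω.2 K hK)⟩

theorem s1_gammaF_omega_iff_nullSelection : S1 (GammaF X) (Omega X) ↔ NullSelection X :=
  ⟨NullSelection.of_s1_gammaF_omega, NullSelection.s1_gammaF_omega⟩

theorem gammaCl_subset_gammaF : GammaCl X ⊆ GammaF X := fun 𝒰 h𝒰 =>
  ⟨fun U hU => isCozeroSet_of_isClopen (h𝒰.1 U hU), h𝒰.2, id,
    fun U hU => ⟨isZeroSet_of_isClopen (h𝒰.1 U hU), subset_rfl⟩, (image_id 𝒰).symm ▸ h𝒰.2⟩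

theorem s1_gammaCl_omegaCl_of_s1_gammaF_omega (h : S1 (GammaF X) (Omega X)) :
    S1 (GammaCl X) (OmegaCl X) := by
  intro 𝒰 h𝒰
  obtain ⟨b, hb, -, hω⟩ := h 𝒰 fun n => gammaCl_subset_gammaF (h𝒰 n)
  exact ⟨b, hb, forall_mem_range.2 fun n => (h𝒰 n).1 _ (hb n), hω⟩

theorem StronglyZeroDimensional.s1_gammaF_omega (hX : StronglyZeroDimensional X)
    (h : S1 (GammaCl X) (OmegaCl X)) : S1 (GammaF X) (Omega X) := by
  intro 𝒰 h𝒰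
  choose U F hU hF hFU hlim using fun n => exists_seq_of_mem_gammaF (h𝒰 n)
  choose C hC hFC hCU using fun n j => hX (F n j) (U n j)ᶜ (hF n j) ((h𝒰 n).1 _ (hU n j))
    (disjoint_compl_right_iff_subset.2 (hFU n j))
  simp only [disjoint_compl_right_iff_subset] at hCU
  have hne (n j) : U n j ≠ univ := fun he => (h𝒰 n).2.1.1.2 (he ▸ hU n j)
  have hcover (n) : range (C n) ∈ GammaCl X := by
    refine ⟨forall_mem_range.2 (hC n), isGammaCover_range
      (fun j he => hne n j (univ_subset_iff.1 (he ▸ hCU n j))) fun x => ?_⟩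
    rw [Nat.cofinite_eq_atTop]
    exact (hlim n x).mono fun j hj => hFC n j hj
  obtain ⟨b, hb, -, hω⟩ := h _ hcover
  choose φ hφ using hb
  obtain rfl : (fun n => C n (φ n)) = b := funext hφ
  refine ⟨fun n => U n (φ n), fun n => hU n _,
    forall_mem_range.2 fun n => ((h𝒰 n).1 _ (hU n _)).isOpen,
    isOmegaCover_range (fun n => hne n _) fun K hK => ?_⟩
  obtain ⟨n, hn⟩ := exists_range_iff.1 (hω.2 K hK)
  exact ⟨n, hn.trans (hCU n _)⟩

end CoverSelection

/-! ### Strong zero-dimensionality -/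

section StronglyZeroDimensional

theorem exists_continuousMap_surjective_hilbertCube :
    ∃ p : C(unitInterval, ℕ → unitInterval), Function.Surjective p := by
  let q : C(cantorSet, ℕ → unitInterval) :=
    ⟨cantorToHilbert ∘ cantorSetHomeomorphNatToBool,
      cantorToHilbert_continuous.comp cantorSetHomeomorphNatToBool.continuous⟩
  obtain ⟨r, hr⟩ := q.exists_restrict_eq isClosed_cantorSet
  refine ⟨r.restrict unitInterval, fun y => ?_⟩
  obtain ⟨s, rfl⟩ := cantorToHilbert_surjective.comp cantorSetHomeomorphNatToBool.surjective y
  exact ⟨⟨s, cantorSet_subset_unitInterval s.2⟩, DFunLike.congr_fun hr s⟩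

theorem exists_null_seq_apply_one_div_eq_one :
    ∃ β : ℕ → ℝ → ℝ, (∀ j, Continuous (β j)) ∧ (∀ y, Tendsto (fun j => β j y) atTop (𝓝 0)) ∧
      ∀ j : ℕ, β j (1 / (j + 1)) = 1 := by
  refine ⟨fun j y => max 0 (1 - |(j + 1) * y - 1|), fun j => by fun_prop, fun y => ?_, fun j => ?_⟩
  · have hvanish : ∀ᶠ j : ℕ in atTop, (1 : ℝ) ≤ |(j + 1) * y - 1| := by
      rcases le_or_gt y 0 with hy | hy
      · refine Eventually.of_forall fun j => le_abs.2 (Or.inr ?_)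
        linarith [mul_nonpos_of_nonneg_of_nonpos j.cast_add_one_pos.le hy]
      · filter_upwards [(tendsto_natCast_atTop_atTop.atTop_mul_const hy).eventually_ge_atTop 2]
          with j hj
        exact le_abs.2 (Or.inl (by linarith))
    exact tendsto_const_nhds.congr' <| hvanish.mono fun j hj =>
      (max_eq_left (sub_nonpos.2 hj)).symm
  · simp [mul_inv_cancel₀ (Nat.cast_add_one_ne_zero (R := ℝ) j)]

theorem not_nullSelection_hilbertCube : ¬ NullSelection (ℕ → unitInterval) := by
  intro h
  obtain ⟨β, hβ, hβ0, hβ1⟩ := exists_null_seq_apply_one_div_eq_one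
  obtain ⟨φ, hφ⟩ := h (fun n j y => β j (y n)) (fun n j => by have := hβ j; fun_prop)
    fun n y => hβ0 _
  let y : ℕ → unitInterval := fun n =>
    ⟨1 / (φ n + 1), by positivity, (div_le_one₀ (by positivity)).2 (by simp)⟩
  obtain ⟨n, hn⟩ := hφ {y} (finite_singleton y)
  simpa only [y, hβ1, abs_one, lt_self_iff_false] using hn y rfl

variable {X : Type*} [TopologicalSpace X]

theorem NullSelection.of_surjective (h : NullSelection X) {Y : Type*} [TopologicalSpace Y]
    {p : X → Y} (hp : Continuous p) (hsurj : Function.Surjective p) : NullSelection Y := by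
  intro g hg hg0
  obtain ⟨φ, hφ⟩ := h (fun n j x => g n j (p x)) (fun n j => (hg n j).comp hp)
    fun n x => hg0 n (p x)
  refine ⟨φ, fun K hK => ?_⟩
  obtain ⟨n, hn⟩ := hφ (Function.surjInv hsurj '' K) (hK.image _)
  refine ⟨n, fun y hy => ?_⟩
  simpa only [Function.surjInv_eq] using hn _ (mem_image_of_mem _ hy)

theorem not_nullSelection_unitInterval : ¬ NullSelection unitInterval := fun h =>
  let ⟨p, hp⟩ := exists_continuousMap_surjective_hilbertCube
  not_nullSelection_hilbertCube (h.of_surjective p.continuous hp)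

theorem NullSelection.exists_notMem_range (h : NullSelection X) {f : X → ℝ} (hf : Continuous f) :
    ∃ t ∈ Icc (0 : ℝ) 1, t ∉ range f := by
  by_contra! hrange
  refine not_nullSelection_unitInterval
    (h.of_surjective (continuous_projIcc.comp hf : Continuous (projIcc 0 1 zero_le_one ∘ f))
      fun t => ?_)
  obtain ⟨x, hx⟩ := hrange t t.2
  exact ⟨x, by simp [hx]⟩

theorem stronglyZeroDimensional_of_forall_exists_notMem_range
    (h : ∀ f : X → ℝ, Continuous f → ∃ t ∈ Icc (0 : ℝ) 1, t ∉ range f) :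
    StronglyZeroDimensional X := by
  intro Z₀ Z₁ h₀ h₁ hd
  obtain ⟨f, hf, hf0, hf1⟩ := h₀.exists_separating h₁ hd
  obtain ⟨t, ht, htf⟩ := h f hf
  have hne (x) : f x ≠ t := fun hx => htf ⟨x, hx⟩
  have hle : f ⁻¹' Iio t = f ⁻¹' Iic t := ext fun x => (hne x).le_iff_lt.symm
  refine ⟨f ⁻¹' Iio t, ⟨hle ▸ isClosed_Iic.preimage hf, isOpen_Iio.preimage hf⟩, fun x hx => ?_,
    disjoint_left.2 fun x hxt hx => ?_⟩
  · exact lt_of_le_of_ne (hf0 x hx ▸ ht.1) (hne x)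
  · exact (hf1 x hx ▸ ht.2 : t ≤ f x).not_gt hxt

theorem NullSelection.stronglyZeroDimensional (h : NullSelection X) : StronglyZeroDimensional X :=
  stronglyZeroDimensional_of_forall_exists_notMem_range fun _ hf => h.exists_notMem_range hf

end StronglyZeroDimensional

/-! ### Pointwise limits of functions factoring through a continuous map -/

section BaireOne

variable {X H : Type*} [TopologicalSpace H] {u : X → H}

/-- `U` is the preimage under `u` of an `F_σ`-set of `H`. For injective `u` this says that `u '' U`
is an `F_σ`-set of `range u`. -/
def IsFSigmaAlong (u : X → H) (U : Set X) : Prop :=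
  ∃ F : ℕ → Set H, (∀ k, IsClosed (F k)) ∧ U = ⋃ k, u ⁻¹' F k

/-- `f` is the pointwise limit of a sequence of functions `d ∘ u` with `d : H → ℝ` continuous. For
injective `u` this says that `f` is of the first Baire class for the topology induced by `u`, with
approximations that extend continuously to `H`. -/
def IsBaireOneAlong (u : X → H) (f : X → ℝ) : Prop :=
  ∃ d : ℕ → C(H, ℝ), ∀ x, Tendsto (fun n => d n (u x)) atTop (𝓝 (f x))

theorem IsBaireOneAlong.isFSigmaAlong_pos {f : X → ℝ} (h : IsBaireOneAlong u f) :
    IsFSigmaAlong u {x | 0 < f x} := by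
  obtain ⟨d, hd⟩ := h
  refine ⟨fun m => ⋂ n ≥ m.unpair.1, {z | 1 / ((m.unpair.2 : ℝ) + 1) ≤ d n z},
    fun m => isClosed_biInter fun n _ => isClosed_le continuous_const (d n).continuous, ?_⟩
  ext x
  simp only [mem_ofPred_eq, mem_iUnion, mem_preimage, mem_iInter]
  constructor
  · intro hpos
    obtain ⟨r, hr⟩ := exists_nat_one_div_lt hpos
    obtain ⟨N, hN⟩ := eventually_atTop.1 ((hd x).eventually_const_le hr)
    exact ⟨Nat.pair N r, by simpa only [Nat.unpair_pair] using hN⟩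
  · rintro ⟨m, hm⟩
    exact Nat.one_div_pos_of_nat.trans_le (ge_of_tendsto (hd x) (eventually_atTop.2 ⟨_, hm⟩))

theorem IsBaireOneAlong.add {f g : X → ℝ} (hf : IsBaireOneAlong u f) (hg : IsBaireOneAlong u g) :
    IsBaireOneAlong u fun x => f x + g x :=
  let ⟨d, hd⟩ := hf
  let ⟨e, he⟩ := hg
  ⟨fun n => d n + e n, fun x => (hd x).add (he x)⟩

theorem IsBaireOneAlong.sub {f g : X → ℝ} (hf : IsBaireOneAlong u f) (hg : IsBaireOneAlong u g) :
    IsBaireOneAlong u fun x => f x - g x :=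
  let ⟨d, hd⟩ := hf
  let ⟨e, he⟩ := hg
  ⟨fun n => d n - e n, fun x => (hd x).sub (he x)⟩

theorem IsBaireOneAlong.exists_bounded {f : X → ℝ} (h : IsBaireOneAlong u f) {M : ℝ} (hM : 0 ≤ M)
    (hf : ∀ x, |f x| ≤ M) :
    ∃ d : ℕ → C(H, ℝ), (∀ n z, |d n z| ≤ M) ∧
      ∀ x, Tendsto (fun n => d n (u x)) atTop (𝓝 (f x)) := by
  obtain ⟨d, hd⟩ := h
  refine ⟨fun n => ⟨fun z => max (-M) (min M (d n z)), by fun_prop⟩, fun n z => ?_, fun x => ?_⟩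
  · exact abs_le.2 ⟨le_max_left _ _, max_le (neg_le_self hM) (min_le_left _ _)⟩
  · have hclip : max (-M) (min M (f x)) = f x := by
      rw [min_eq_right (abs_le.1 (hf x)).2, max_eq_right (abs_le.1 (hf x)).1]
    have hlim : Tendsto (fun n => max (-M) (min M (d n (u x)))) atTop
        (𝓝 (max (-M) (min M (f x)))) := tendsto_const_nhds.max (tendsto_const_nhds.min (hd x))
    rwa [hclip] at hlim

theorem IsBaireOneAlong.tsum {f : ℕ → X → ℝ} {M : ℕ → ℝ} (h : ∀ k, IsBaireOneAlong u (f k))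
    (hM0 : ∀ k, 0 ≤ M k) (hM : Summable M) (hf : ∀ k x, |f k x| ≤ M k) :
    IsBaireOneAlong u fun x => ∑' k, f k x := by
  choose d hdM hd using fun k => (h k).exists_bounded (hM0 k) (hf k)
  refine ⟨fun n => ⟨fun z => ∑' k, d k n z, ?_⟩, fun x => ?_⟩
  · exact continuous_tsum (fun k => (d k n).continuous) hM fun k z => hdM k n z
  · exact tendsto_tsum_of_dominated_convergence hM (fun k => hd k x)
      (Eventually.of_forall fun n k => hdM k n (u x))

theorem IsBaireOneAlong.of_forall_approx {f : X → ℝ}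
    (h : ∀ ε > 0, ∃ s, IsBaireOneAlong u s ∧ ∀ x, |s x - f x| ≤ ε) : IsBaireOneAlong u f := by
  choose s hs hsf using fun k : ℕ => h ((1 / 2) ^ k) (by positivity)
  have hstep (k x) : |s (k + 1) x - s k x| ≤ 2 * (1 / 2) ^ k := by
    calc |s (k + 1) x - s k x| ≤ |s (k + 1) x - f x| + |f x - s k x| := abs_sub_le _ _ _
      _ ≤ (1 / 2) ^ (k + 1) + (1 / 2) ^ k :=
        add_le_add (hsf _ x) ((abs_sub_comm _ _).trans_le (hsf k x))
      _ ≤ 2 * (1 / 2) ^ k := by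
        rw [pow_succ]
        linarith [pow_pos (one_half_pos (α := ℝ)) k]
  have hsummable : Summable fun k : ℕ => 2 * (1 / 2 : ℝ) ^ k := summable_geometric_two.mul_left 2
  have hlim (x) : Tendsto (fun k => s k x) atTop (𝓝 (f x)) :=
    tendsto_iff_norm_sub_tendsto_zero.2 <| squeeze_zero (fun _ => norm_nonneg _) (hsf · x)
      (tendsto_pow_atTop_nhds_zero_of_lt_one one_half_pos.le one_half_lt_one)
  have htelescope (x) : s 0 x + ∑' k, (s (k + 1) x - s k x) = f x := by
    have hsum : Tendsto (fun n => ∑ k ∈ Finset.range n, (s (k + 1) x - s k x)) atTop _ :=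
      (hsummable.of_norm_bounded fun k => hstep k x).hasSum.tendsto_sum_nat
    simp only [Finset.sum_range_sub fun k => s k x] at hsum
    rw [tendsto_nhds_unique hsum ((hlim x).sub_const (s 0 x)), add_sub_cancel]
  rw [← funext htelescope]
  exact (hs 0).add (.tsum (fun k => (hs (k + 1)).sub (hs k)) (fun k => by positivity) hsummable
    hstep)

theorem exists_seq_tendsto_indicator [HasOuterApproxClosed H] {R : Set H} (hR : IsClosed R) :
    ∃ ψ : ℕ → C(H, ℝ), (∀ n, ∀ z ∈ R, ψ n z = 1) ∧
      ∀ z ∉ R, Tendsto (fun n => ψ n z) atTop (𝓝 0) := by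
  refine ⟨fun n => ⟨fun z => hR.apprSeq n z, by fun_prop⟩, fun n z hz => ?_, fun z hz => ?_⟩
  · simp [HasOuterApproxClosed.apprSeq_apply_eq_one hR n hz]
  · simpa [hz] using NNReal.tendsto_coe.2
      (tendsto_pi_nhds.1 (HasOuterApproxClosed.tendsto_apprSeq hR) z)

open Classical in
theorem isBaireOneAlong_find [HasOuterApproxClosed H] {R : ℕ → Set H} (hR : ∀ j, IsClosed (R j))
    (hcov : ∀ x, ∃ j, u x ∈ R j) (c : ℕ → ℝ) :
    IsBaireOneAlong u fun x => c (Nat.find (hcov x)) := by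
  choose ψ hψ1 hψ0 using fun j => exists_seq_tendsto_indicator (hR j)
  refine ⟨fun n => ∑ j ∈ Finset.range n, c j • (ψ j n * ∏ i ∈ Finset.range j, (1 - ψ i n)),
    fun x => ?_⟩
  change Tendsto _ _ (𝓝 (c (Nat.find (hcov x))))
  have hJ : u x ∈ R (Nat.find (hcov x)) := Nat.find_spec (hcov x)
  have hlt : ∀ i < Nat.find (hcov x), u x ∉ R i := fun i => Nat.find_min (hcov x)
  generalize Nat.find (hcov x) = J at hJ hlt
  have hprod : ∀ j ≤ J, Tendsto (fun n => ∏ i ∈ Finset.range j, (1 - ψ i n (u x))) atTop (𝓝 1) :=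
    fun j hj => by
      simpa using tendsto_finsetProd (Finset.range j) fun i hi =>
        (hψ0 i _ (hlt i ((Finset.mem_range.1 hi).trans_le hj))).const_sub 1
  have hhead : Tendsto (fun n => ∑ j ∈ Finset.range J,
      c j * (ψ j n (u x) * ∏ i ∈ Finset.range j, (1 - ψ i n (u x)))) atTop (𝓝 0) := by
    simpa using tendsto_finsetSum (Finset.range J) fun j hj =>
      ((hψ0 j _ (hlt j (Finset.mem_range.1 hj))).mul
        (hprod j (Finset.mem_range.1 hj).le)).const_mul (c j)
  have hlast : Tendsto (fun n => c J * (ψ J n (u x) * ∏ i ∈ Finset.range J, (1 - ψ i n (u x))))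
      atTop (𝓝 (c J)) := by
    simpa [hψ1 J _ _ hJ] using (hprod J le_rfl).const_mul (c J)
  -- The terms of index `j > J` vanish: their product contains the factor `1 - 1` of index `J`.
  refine (zero_add (c J) ▸ hhead.add hlast).congr' ?_
  filter_upwards [eventually_gt_atTop J] with n hn
  rw [← Finset.sum_range_succ, ContinuousMap.sum_apply]
  refine (Finset.sum_subset (Finset.range_mono hn) fun j _ hj => ?_).trans
    (Finset.sum_congr rfl fun j _ => ?_)
  · have hJj : J ∈ Finset.range j := by grind
    rw [Finset.prod_eq_zero hJj (by rw [hψ1 J n _ hJ, sub_self]), mul_zero, mul_zero]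
  · simp

/-- The Lebesgue–Hausdorff theorem. Given a cover by closed sets, one for each of countably many
pieces on which `f` is nearly constant, the first member containing `u x` provides an approximation
to `f x`. -/
theorem isBaireOneAlong_of_forall_isFSigmaAlong_ball [HasOuterApproxClosed H] {f : X → ℝ}
    (h : ∀ c r : ℝ, IsFSigmaAlong u (f ⁻¹' Metric.ball c r)) : IsBaireOneAlong u f := by
  refine .of_forall_approx fun ε hε => ?_
  obtain ⟨q, hq⟩ := TopologicalSpace.exists_dense_seq ℝ
  choose F hF hFq using fun i => h (q i) ε
  have hcov (x) : ∃ j : ℕ, u x ∈ F j.unpair.1 j.unpair.2 := by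
    obtain ⟨i, hi⟩ := hq.exists_dist_lt (f x) hε
    obtain ⟨k, hk⟩ := mem_iUnion.1 ((hFq i).le hi)
    exact ⟨Nat.pair i k, by rwa [Nat.unpair_pair]⟩
  classical
  refine ⟨_, isBaireOneAlong_find (fun j => hF j.unpair.1 j.unpair.2) hcov fun j => q j.unpair.1,
    fun x => ?_⟩
  have hball := (hFq _).ge (mem_iUnion_of_mem _ (Nat.find_spec (hcov x)))
  rw [abs_sub_comm]
  exact (Metric.mem_ball.1 hball).le

end BaireOne

/-! ### Velichko's property and sequential separability -/

section Velichko

universe v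

variable {X : Type v} [TopologicalSpace X]

theorem VelichkoV.exists_continuous_hilbertCube (h : VelichkoV X) :
    ∃ u : X → ℕ → unitInterval, Continuous u ∧ ∀ U, IsCozeroSet U → IsFSigmaAlong u U := by
  obtain ⟨Y, _, _, f, hf, hbij, hσ⟩ := h
  obtain ⟨ι, hι⟩ := Metric.PiNatEmbed.exists_embedding_to_hilbert_cube (X := Y)
  refine ⟨ι ∘ f, hι.continuous.comp hf, fun U hU => ?_⟩
  obtain ⟨F, hF, hFU⟩ := hσ U hU
  choose R hR hRF using fun k => hι.isInducing.isClosed_iff.1 (hF k)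
  refine ⟨R, hR, ?_⟩
  simp only [preimage_comp, hRF, ← preimage_iUnion, ← hFU, hbij.1.preimage_image]

theorem velichkoV_of_injective {H : Type*} [TopologicalSpace H]
    [TopologicalSpace.MetrizableSpace H] [SecondCountableTopology H] {u : X → H}
    (hu : Continuous u) (hinj : Function.Injective u)
    (h : ∀ U, IsCozeroSet U → IsFSigmaAlong u U) : VelichkoV X := by
  refine ⟨X, (TopologicalSpace.metrizableSpaceMetric H).induced u hinj, ?_, id,
    continuous_induced_rng.2 hu, Function.bijective_id, fun U hU => ?_⟩
  · exact @TopologicalSpace.SecondCountableTopology.to_separableSpace X (.induced u inferInstance)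
      (TopologicalSpace.secondCountableTopology_induced X H u)
  · obtain ⟨F, hF, rfl⟩ := h U hU
    exact ⟨fun k => u ⁻¹' F k, fun k => isClosed_induced_iff.2 ⟨F k, hF k, rfl⟩, image_id _⟩

theorem sequentiallySeparable_of_forall_isBaireOneAlong {H : Type*} [TopologicalSpace H]
    [T2Space H] [CompactSpace H] [SecondCountableTopology H] {u : X → H} (hu : Continuous u)
    (h : ∀ f : X → ℝ, Continuous f → IsBaireOneAlong u f) : SequentiallySeparable (Cp X) := by
  obtain ⟨D, hDc, hD⟩ := TopologicalSpace.exists_countable_dense C(H, ℝ)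
  let pullback (d : C(H, ℝ)) : Cp X := ⟨d ∘ u, d.continuous.comp hu⟩
  refine ⟨pullback '' D, hDc.image _, eq_univ_of_forall fun f => ?_⟩
  obtain ⟨d, hd⟩ := h f.1 f.2
  choose e heD he using fun n : ℕ => hD.exists_dist_lt (d n) (Nat.one_div_pos_of_nat (n := n))
  refine ⟨fun n => pullback (e n), fun n => mem_image_of_mem _ (heD n),
    Cp.tendsto_iff.2 fun x => tendsto_of_tendsto_of_dist (hd x) ?_⟩
  exact squeeze_zero (fun _ => dist_nonneg)
    (fun n => (ContinuousMap.dist_apply_le_dist (u x)).trans (he n).le)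
    tendsto_one_div_add_atTop_nhds_zero_nat

theorem VelichkoV.sequentiallySeparable (h : VelichkoV X) : SequentiallySeparable (Cp X) := by
  obtain ⟨u, hu, hσ⟩ := h.exists_continuous_hilbertCube
  refine sequentiallySeparable_of_forall_isBaireOneAlong hu fun f hf =>
    isBaireOneAlong_of_forall_isFSigmaAlong_ball fun c r => hσ _ ?_
  exact isCozeroSet_lt (hf.dist continuous_const) continuous_const

theorem SequentiallySeparable.velichkoV (hs : SequentiallySeparable (Cp X))
    (hX : {f : X → ℝ | Continuous f}.SeparatesPoints) : VelichkoV X := by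
  obtain ⟨d, hd⟩ := hs.exists_seq
  let p : X → ℕ → ℝ := fun x n => (d n).1 x
  have hbaire (f : X → ℝ) (hf : Continuous f) : IsBaireOneAlong p f :=
    let ⟨k, _, hk⟩ := hd ⟨f, hf⟩
    ⟨fun i => ⟨fun y => y (k i), continuous_apply _⟩, Cp.tendsto_iff.1 hk⟩
  refine velichkoV_of_injective (u := p) (continuous_pi fun n => (d n).2) (fun x y hxy => ?_) ?_
  · by_contra hne
    obtain ⟨f, hf, hfxy⟩ := hX hne
    obtain ⟨e, he⟩ := hbaire f hf
    exact hfxy (tendsto_nhds_unique (he x) (hxy ▸ he y))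
  · rintro U ⟨f, hf, hU⟩
    have hpos : U = {x | 0 < |f x|} := by
      rw [← compl_compl U, hU]
      ext x
      simp
    exact hpos ▸ (hbaire _ hf.abs).isFSigmaAlong_pos

theorem velichkoV_iff_sequentiallySeparable (hX : {f : X → ℝ | Continuous f}.SeparatesPoints) :
    VelichkoV X ↔ SequentiallySeparable (Cp X) :=
  ⟨VelichkoV.sequentiallySeparable, fun h => h.velichkoV hX⟩

end Velichko

end SelectionPrinciples

open SelectionPrinciples in
theorem mainTheorem3_general {X : Type*} [TopologicalSpace X] [Nonempty X]
    (hX : {f : X → ℝ | Continuous f}.SeparatesPoints) :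
    List.TFAE [
      S1 (seqDenseSets (Cp X)) (denseSets (Cp X)) ∧ SequentiallySeparable (Cp X),
      S1 (GammaF X) (Omega X) ∧ VelichkoV X,
      S1 (GammaCl X) (OmegaCl X) ∧ VelichkoV X ∧ StronglyZeroDimensional X,
      (∀ f : Cp X, S1 (GammaAt f) (OmegaAt f)) ∧ SequentiallySeparable (Cp X),
      (∀ f : Cp X, S1 (seqDenseSets (Cp X)) (OmegaAt f)) ∧ SequentiallySeparable (Cp X)] := by
  rw [velichkoV_iff_sequentiallySeparable hX, s1_gammaF_omega_iff_nullSelection,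
    ← nullSelection_iff_forall_s1_gammaAt_omegaAt]
  let f₀ : Cp X := ⟨0, continuous_zero⟩
  tfae_have 2 → 1 := fun h =>
    have := h.2.separableSpace
    ⟨s1_seqDenseSets_denseSets h.1.convergentSelectionAt, h.2⟩
  tfae_have 1 → 2 := fun h => ⟨h.2.nullSelection (f := f₀) (h.1.mono fun A hA => hA _), h.2⟩
  tfae_have 2 → 3 := fun h =>
    ⟨s1_gammaCl_omegaCl_of_s1_gammaF_omega h.1.s1_gammaF_omega, h.2, h.1.stronglyZeroDimensional⟩
  tfae_have 3 → 2 := fun h => ⟨.of_s1_gammaF_omega (h.2.2.s1_gammaF_omega h.1), h.2.1⟩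
  tfae_have 2 ↔ 4 := Iff.rfl
  tfae_have 2 → 5 := fun h =>
    have := h.2.separableSpace
    ⟨fun f => s1_seqDenseSets_omegaAt h.1.convergentSelectionAt f, h.2⟩
  tfae_have 5 → 2 := fun h => ⟨h.2.nullSelection ((h.1 f₀).mono fun A hA => hA.1), h.2⟩
  tfae_finish

theorem mainTheorem3 {X : Type*} [TopologicalSpace X] [T35Space X] [Nonempty X] :
    List.TFAE [
      SelectionPrinciples.S1 (SelectionPrinciples.seqDenseSets (SelectionPrinciples.Cp X))
          (SelectionPrinciples.denseSets (SelectionPrinciples.Cp X)) ∧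
        SelectionPrinciples.SequentiallySeparable (SelectionPrinciples.Cp X),
      SelectionPrinciples.S1 (SelectionPrinciples.GammaF X) (SelectionPrinciples.Omega X) ∧
        SelectionPrinciples.VelichkoV X,
      SelectionPrinciples.S1 (SelectionPrinciples.GammaCl X) (SelectionPrinciples.OmegaCl X) ∧
        SelectionPrinciples.VelichkoV X ∧
        SelectionPrinciples.StronglyZeroDimensional X,
      (∀ f : SelectionPrinciples.Cp X,
          SelectionPrinciples.S1 (SelectionPrinciples.GammaAt f) (SelectionPrinciples.OmegaAt f)) ∧
        SelectionPrinciples.SequentiallySeparable (SelectionPrinciples.Cp X),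
      (∀ f : SelectionPrinciples.Cp X,
          SelectionPrinciples.S1 (SelectionPrinciples.seqDenseSets (SelectionPrinciples.Cp X))
            (SelectionPrinciples.OmegaAt f)) ∧
        SelectionPrinciples.SequentiallySeparable (SelectionPrinciples.Cp X)] :=
  mainTheorem3_general separatesPoints_continuous_of_t35Space
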